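/- **Setting.** Let $(E,J)$ be a topos, given as a category with finite limits and a Grothendieck topology. An $n$-gerbed tower with commutative bands consists of functors $F_n\xrightarrow{p_n}F_{n-1}\to\dots\to F_1\xrightarrow{p_1}F_0=E$ and sheaves of abelian groups $L_1,\dots,L_n$ on $E$ (the arrows $x\to y$ of $F_l$ are the 2-arrows of a 2-category with the same objects, whose 1-arrows between $x$ and $y$ are the arrows $p_l(x)\to p_l(y)$ of $F_{l-1}$), such that: 1. each object $x$ of $F_l$, $1\le l\le n$, has an attached topos $T(x)$, and the arrows $x\to y$ of $F_l$ form, compatibly with composition, a subset of the continuous functors $T(x)\to T(y)$; 2. $F_1\to E$ is a gerbe bounded by $L_1$; an arrow of $F_l$ over an invertible arrow of $E$ is invertible; 3. for each arrow $f:V\to W$ of $E$ there is a restriction functor $F_l(W)\to F_l(V)$ between the fibers of $F_l\to E$; these functors are strictly functorial in $f$, commute with the $p_l$, and are inverse image functors for $l=1$; 4. for each object $x$ of $F_{l}$ over $V\in E$, $1\le l<n$, the fiber of $p_{l+1}$ over $x$ is the category of global objects of a gerbe on $T(x)$ bounded by a sheaf with global sections $L_{l+1}(V)$; through this, for $1\le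 l\le n$, $L_l(V)$ is the group of automorphisms, over the identity in $F_{l-1}$, of every object of $F_l$ over $V$, compatibly with restriction; 5. for each arrow $f:x_1\to x_2$ of $F_l$, $1\le l<n$, and each $y_2$ in $F_{l+1}$ over $x_2$ there are $y_1$ over $x_1$ and an arrow $y_1\to y_2$ over $f$. Moreover there are sheaves of abelian groups $L'_{l+1}$ on $E$, $1\le l<n$, such that for every object $y$ of $F_{l+1}$ over $V$ the group $L'_{l+1}(V)$ is, compatibly with restriction, the group of automorphisms of $y$ whose image in $F_l$ belongs to $L_l(V)$; the inclusion of the automorphisms over the identity and the projection are given by morphisms of sheaves $L_{l+1}\to L'_{l+1}\to L_l$. Let $(U_i)_{i\in I}$ be a covering family of $E$, and $U_{i_1\dots i_k}=U_{i_1}\times\dots\times U_{i_k}$. Assume that $F_1(U_i)$ is non-empty and its objects are isomorphic, that the objects of $F_1(U_i\times U_j)$ are isomorphic, and that for each object $x$ of $F_l$, $1\le l<n$, over some $U_{i_1\dots i_k}$, $k\ge 1$, the fiber of $F_{l+1}$ over $x$ is non-empty and its objects are isomorphic. $H^*(E,-)$ is Čech cohomology with respect to $(U_i)$. **Classifying cocycles.**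 Choose objects $u_i$ of $F_1(U_i)$ and isomorphisms $v_{ij}:u_j\to u_i$ over $U_{ij}$; then $c_2\in C^2(L_1)$ is given by $c_{ijk}=v_{ik}^{-1}v_{ij}v_{jk}$, an automorphism of the restriction of $u_k$ to $U_{ijk}$. Given $c_{l+1}\in C^{l+1}(L_l)$, acting by automorphisms of objects $x_{i_1\dots i_{l+2}}$ of $F_l$ over $U_{i_1\dots i_{l+2}}$, choose objects $u_{i_1\dots i_{l+2}}$ of $F_{l+1}$ over the $x_{i_1\dots i_{l+2}}$, and automorphisms $c^*_{i_1\dots i_{l+2}}\in L'_{l+1}(U_{i_1\dots i_{l+2}})$ of $u_{i_1\dots i_{l+2}}$ over $c_{i_1\dots i_{l+2}}$; then $c_{l+2}\in C^{l+2}(L_{l+1})$ is the Čech boundary of $c^*$, acting on the restrictions of the $u_{i_1\dots i_{l+2}}$ to $U_{i_1\dots i_{l+3}}$. **Proposition 4.2.3.** The cochains $c_l$, $2\le l\le n+1$, can be constructed, and are cocycles. For $1\le l<n$ the sequence $0\to L_{l+1}\to L'_{l+1}\to L_l\to 0$ induces a short exact sequence of Čech complexes, and the class $[c_{l+2}]$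 is the image of $[c_{l+1}]$ under its connecting morphism $H^{l+1}(E,L_l)\to H^{l+2}(E,L_{l+1})$. The cohomology classes $[c_l]\in H^l(E,L_{l-1})$, $2\le l\le n+1$, do not depend on the choices made to construct them. -/

import Mathlib

open CategoryTheory Limits Opposite

universe w v u v' u' v₁ u₁ v₂ u₂

namespace GerbedTower

/-! ### Gerbes on a site, bounded by a sheaf of abelian groups -/

/-- The automorphisms of `x` which the functor `h` sends to the identity. -/
def vertAut {C : Type u₁} [Category.{v₁} C] {G : Type u₂} [Category.{v₂} G]
    (h : G ⥤ C) (x : G) : Subgroup (Aut x) :=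
  (h.mapAut x).ker

/-- A functor `h : G ⥤ C` is a gerbe on the site `(C, J)`: it is a category fibered in groupoids,
arrows and objects can be glued (it is a stack), objects exist locally, and any two objects of the
same fiber are locally isomorphic. -/
structure IsGerbe {C : Type u₁} [Category.{v₁} C] (J : GrothendieckTopology C)
    {G : Type u₂} [Category.{v₂} G] (h : G ⥤ C) : Prop where
  fibered : h.IsFibered
  isIso_fiber : ∀ (S : C) (x y : h.Fiber S) (φ : x ⟶ y), IsIso φ
  /-- Gluing of arrows: for `x`, `y` in the same fiber, an arrow `x ⟶ y` of the fiber is the same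
  as a compatible family of arrows `z ⟶ y`, one for each arrow `a : z ⟶ x` lying over an arrow of
  a given covering sieve. -/
  glue_hom : ∀ (x : G) (y : h.Fiber (h.obj x)) (R : Sieve (h.obj x)), R ∈ J (h.obj x) →
    ∀ φ : (∀ ⦃z : G⦄ (a : z ⟶ x), R (h.map a) → (z ⟶ y.1)),
      (∀ ⦃z : G⦄ (a : z ⟶ x) (ha : R (h.map a)), h.IsHomLift (h.map a) (φ a ha)) →
      (∀ ⦃z z' : G⦄ (b : z' ⟶ z) (a : z ⟶ x) (ha : R (h.map a)) (hba : R (h.map (b ≫ a))),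
        φ (b ≫ a) hba = b ≫ φ a ha) →
      ∃! ψ : x ⟶ y.1, h.IsHomLift (𝟙 (h.obj x)) ψ ∧
        ∀ ⦃z : G⦄ (a : z ⟶ x) (ha : R (h.map a)), a ≫ ψ = φ a ha
  /-- Gluing of objects: a section of `h` over a covering sieve of `S` comes from an object
  over `S`. -/
  glue_obj : ∀ (S : C) (R : Sieve S), R ∈ J S → ∀ D : R.arrows.category ⥤ G,
    D ⋙ h = R.arrows.diagram →
    ∃ (x : h.Fiber S) (a : ∀ f : R.arrows.category, D.obj f ⟶ x.1),
      (∀ f, h.IsHomLift f.obj.hom (a f)) ∧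
      ∀ (f g : R.arrows.category) (k : f ⟶ g), D.map k ≫ a g = a f
  locally_nonempty : ∀ S : C, ∃ R ∈ J S, ∀ (V : C) (f : V ⟶ S), R f → Nonempty (h.Fiber V)
  locally_connected : ∀ (S : C) (x y : h.Fiber S), ∃ R ∈ J S, ∀ (V : C) (f : V ⟶ S), R f →
    ∃ (z : G) (a : z ⟶ x.1) (b : z ⟶ y.1), h.IsHomLift f a ∧ h.IsHomLift f b

/-- `act` exhibits the presheaf of abelian groups `L` as the band of `h : G ⥤ C`: it identifies,
for each `x` over `S`, the group `L(S)` with the automorphisms of `x` over `𝟙 S`, and it commutes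
with restrictions and with morphisms between objects. -/
structure IsBand {C : Type u₁} [Category.{v₁} C] {G : Type u₂} [Category.{v₂} G] (h : G ⥤ C)
    (L : Cᵒᵖ ⥤ AddCommGrpCat.{w})
    (act : ∀ ⦃S : C⦄ (x : h.Fiber S), Multiplicative (L.obj (op S)) →* Aut x.1) : Prop where
  injective : ∀ ⦃S : C⦄ (x : h.Fiber S), Function.Injective (act x)
  range_eq : ∀ ⦃S : C⦄ (x : h.Fiber S), (act x).range = vertAut h x.1
  natural : ∀ ⦃S S' : C⦄ (f : S ⟶ S') (x : h.Fiber S) (y : h.Fiber S') (a : x.1 ⟶ y.1),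
    h.IsHomLift f a → ∀ c : L.obj (op S'),
      (act x (.ofAdd (L.map f.op c))).hom ≫ a = a ≫ (act y (.ofAdd c)).hom

/-! ### Classes of cochains -/

/-- `ξ` is the cohomology class of the cochain `c`; in particular `c` is a cocycle. -/
def HasClass {K : CochainComplex AddCommGrpCat.{w} ℕ} {k : ℕ} (c : K.X k) (ξ : K.homology k) :
    Prop :=
  ∃ z : K.cycles k, K.iCycles k z = c ∧ K.homologyπ k z = ξ

/-! ### Towers -/

/-- A sequence `⋯ ⥤ F 2 ⥤ F 1 ⥤ F 0` of functors, `F 0` being the base `E`.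
The `2`-category at level `l + 1` is the one attached to the functor `p l : F (l + 1) ⥤ F l`, in
the same way as the `2`-category `C(E, F)` is attached to a gerbe `F ⥤ E`: its objects are
the objects of `F (l + 1)`, a `1`-arrow between `x` and `y` is an arrow `p x ⟶ p y` of `F l` (that
is a `2`-arrow of the preceding level), and a `2`-arrow between `x` and `y` is an arrow `x ⟶ y` of
`F (l + 1)`, which lies over the `1`-arrow `p x ⟶ p y` that is its image. Hence `2`-functors
commuting with the projections are functors between the categories of `2`-arrows. -/
structure CatTower where
  /-- the objects of the level `l` -/
  F : ℕ → Type u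
  [cat : ∀ l, Category.{v} (F l)]
  p : ∀ l, F (l + 1) ⥤ F l

attribute [instance] CatTower.cat

namespace CatTower

variable (X : CatTower.{v, u})

/-- The base. -/
abbrev E : Type u := X.F 0

/-- The composed projection `F l ⥤ E`. -/
def q : ∀ l, X.F l ⥤ X.E
  | 0 => 𝟭 _
  | l + 1 => X.p l ⋙ q l

/-- The fiber of `F l` over an object of `E`: its arrows lie over the identity. -/
abbrev Fib (l : ℕ) (V : X.E) : Type u := (X.q l).Fiber V

/-- The functor between the fibers over `V` induced by `p l`. -/
def fibMap (l : ℕ) (V : X.E) : X.Fib (l + 1) V ⥤ X.Fib l V where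
  obj y := ⟨(X.p l).obj y.1, y.2⟩
  map {y z} φ := ⟨(X.p l).map φ.1, by
    have := φ.2
    have e : (X.q l).map ((X.p l).map φ.1) = _ := IsHomLift.fac' (X.q (l + 1)) (𝟙 V) φ.1
    exact IsHomLift.of_fac' _ _ _ y.2 z.2 e⟩
  map_id y := by
    apply Subtype.ext
    exact (X.p l).map_id y.1
  map_comp φ ψ := by
    apply Subtype.ext
    exact (X.p l).map_comp φ.1 ψ.1

/-- An object of `F (l + 1)` in the fiber over `x : F l`, as an object of the fiber over the image
of `x` in `E`. -/
def toFib {l : ℕ} {x : X.F l} (y : (X.p l).Fiber x) : X.Fib (l + 1) ((X.q l).obj x) :=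
  ⟨y.1, congrArg (X.q l).obj y.2⟩

end CatTower

/-- The data of a gerbed tower with commutative bands (the conditions are in `IsGerbedTower` and
`IsCommutative`). A topos is given by a site. Only the levels up to the length of the tower play
a role. -/
structure TowerData extends CatTower.{v, u} where
  /-- the topology of the base -/
  J : GrothendieckTopology toCatTower.E
  /-- the topos attached to an object of `F (l + 1)`, and the map of topoi attached to
  a `2`-arrow -/
  T : ∀ l, F (l + 1) ⥤ Cat.{v', u'}
  JT : ∀ (l : ℕ) (x : F (l + 1)), GrothendieckTopology ((T l).obj x)
  /-- the restriction functors, which are strictly functorial -/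
  res : ∀ (l : ℕ) {V W : toCatTower.E} (_ : V ⟶ W), toCatTower.Fib l W ⥤ toCatTower.Fib l V
  res_id : ∀ (l : ℕ) (V : toCatTower.E), res l (𝟙 V) = 𝟭 _
  res_comp : ∀ (l : ℕ) {V W Z : toCatTower.E} (f : V ⟶ W) (g : W ⟶ Z),
    res l g ⋙ res l f = res l (f ≫ g)
  /-- `L (l + 1)` is the band of the fibers of `F (l + 1)` over `F l` -/
  L : ℕ → Sheaf J AddCommGrpCat.{w}
  /-- the sections of `L' (l + 2)` are the automorphisms in `F (l + 2)` which lie over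
  the sections of `L (l + 1)` -/
  L' : ℕ → Sheaf J AddCommGrpCat.{w}
  ι : ∀ l, L (l + 2) ⟶ L' (l + 2)
  π : ∀ l, L' (l + 2) ⟶ L (l + 1)
  act : ∀ (l : ℕ) ⦃V : toCatTower.E⦄ (x : toCatTower.Fib (l + 1) V),
    Multiplicative ((L (l + 1)).obj.obj (op V)) →* Aut x.1
  act' : ∀ (l : ℕ) ⦃V : toCatTower.E⦄ (y : toCatTower.Fib (l + 2) V),
    Multiplicative ((L' (l + 2)).obj.obj (op V)) →* Aut y.1

namespace TowerData

variable (X : TowerData.{w, v, u, v', u'})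

/-- The fiber of `F (l + 2)` over `x : F (l + 1)` is a gerbe on the topos attached to `x`, bounded
by a sheaf `M` whose global sections are the sections of `L (l + 2)` over the image of `x` in `E`:
it is the category of global objects of such a gerbe, and the global sections of the band act
through `act`. -/
def FiberIsGerbe (l : ℕ) (x : X.F (l + 1)) : Prop :=
  ∃ (G : Type (max u u')) (_ : Category.{max v v'} G) (h : G ⥤ (X.T l).obj x)
    (M : Sheaf (X.JT l x) AddCommGrpCat.{w})
    (β : ∀ ⦃S : (X.T l).obj x⦄ (z : h.Fiber S), Multiplicative (M.obj.obj (op S)) →* Aut z.1)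
    (t : (X.T l).obj x) (_ : IsTerminal t)
    (γ : (X.L (l + 2)).obj.obj (op ((X.q (l + 1)).obj x)) ≃+ M.obj.obj (op t))
    (e : (X.p (l + 1)).Fiber x ≌ h.Fiber t),
    IsGerbe (X.JT l x) h ∧ IsBand h M.obj β ∧
    ∀ (y : (X.p (l + 1)).Fiber x) (c : (X.L (l + 2)).obj.obj (op ((X.q (l + 1)).obj x)))
      (φ : y ⟶ y), φ.1 = (X.act (l + 1) (X.toFib y) (.ofAdd c)).hom →
        (e.functor.map φ).1 = (β (e.functor.obj y) (.ofAdd (γ c))).hom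

/-- `X` is an `n`-gerbed tower `F n ⥤ ⋯ ⥤ F 1 ⥤ E` bounded by the sheaves
`L 1, …, L n` of abelian groups. -/
structure IsGerbedTower (n : ℕ) : Prop where
  /-- The objects are topoi, and the `2`-arrows between two objects form a subset of the
  continuous maps between the topoi. -/
  hasFiniteLimits : ∀ l < n, ∀ x : X.F (l + 1), HasFiniteLimits ((X.T l).obj x)
  isContinuous : ∀ l < n, ∀ (x y : X.F (l + 1)) (f : x ⟶ y),
    ((X.T l).map f).toFunctor.IsContinuous (X.JT l x) (X.JT l y)
  faithful : ∀ l < n, (X.T l).Faithful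
  /-- `F 1` is a gerbe on `E` bounded by `L 1`. -/
  gerbe_one : 0 < n → IsGerbe X.J (X.q 1)
  band_one : 0 < n → IsBand (X.q 1) (X.L 1).obj (X.act 0)
  /-- The `2`-arrows over an invertible arrow of `E` are invertible. -/
  invertible : ∀ l < n, ∀ (x y : X.F (l + 1)) (f : x ⟶ y),
    IsIso ((X.q (l + 1)).map f) → IsIso f
  /-- The restriction functors commute with the projections; in the gerbe `F 1` they are
  inverse image functors. -/
  res_fibMap : ∀ l, l + 1 < n → ∀ {V W : X.E} (f : V ⟶ W),
    X.res (l + 2) f ⋙ X.fibMap (l + 1) V = X.fibMap (l + 1) W ⋙ X.res (l + 1) f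
  res_one : 0 < n → ∀ {V W : X.E} (f : V ⟶ W),
    ∃ j : ∀ x : X.Fib 1 W, ((X.res 1 f).obj x).1 ⟶ x.1,
      (∀ x, (X.q 1).IsHomLift f (j x)) ∧
      ∀ (x y : X.Fib 1 W) (φ : x ⟶ y), ((X.res 1 f).map φ).1 ≫ j y = j x ≫ φ.1
  /-- `L (l + 1)(V)` is the group of automorphisms over the identity of each object of `F (l + 1)`
  over `V`, compatibly with restrictions. -/
  act_injective : ∀ l < n, ∀ ⦃V : X.E⦄ (x : X.Fib (l + 1) V), Function.Injective (X.act l x)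
  act_range : ∀ l < n, ∀ ⦃V : X.E⦄ (x : X.Fib (l + 1) V),
    (X.act l x).range = vertAut (X.p l) x.1
  act_res : ∀ l < n, ∀ ⦃V W : X.E⦄ (f : V ⟶ W) (x : X.Fib (l + 1) W)
    (c : (X.L (l + 1)).obj.obj (op W)) (φ : x ⟶ x), φ.1 = (X.act l x (.ofAdd c)).hom →
      ((X.res (l + 1) f).map φ).1 =
        (X.act l ((X.res (l + 1) f).obj x) (.ofAdd ((X.L (l + 1)).obj.map f.op c))).hom
  /-- The fibers of `F (l + 2)` over `F (l + 1)` are gerbes bounded by `L (l + 2)`. -/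
  fiber_gerbe : ∀ l, l + 1 < n → ∀ x : X.F (l + 1), X.FiberIsGerbe l x
  /-- Every `2`-arrow lifts to the next level, with a prescribed target. -/
  lift : ∀ l, l + 1 < n → ∀ (x₁ x₂ : X.F (l + 1)) (f : x₁ ⟶ x₂) (y₂ : (X.p (l + 1)).Fiber x₂),
    ∃ (y₁ : (X.p (l + 1)).Fiber x₁) (f' : y₁.1 ⟶ y₂.1), (X.p (l + 1)).IsHomLift f f'

/-- The standing assumption on the sheaves `L' 2, …, L' n`: for each object `y` of `F (l + 2)`
over `V`, the group `L' (l + 2)(V)` is the group of the automorphisms of `y` whose image in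
`F (l + 1)` is in `L (l + 1)(V)`, compatibly with restrictions; `ι` is the inclusion of the
automorphisms over the identity, and `π` is the projection. -/
structure IsCommutative (n : ℕ) : Prop where
  act'_injective : ∀ l, l + 1 < n → ∀ ⦃V : X.E⦄ (y : X.Fib (l + 2) V),
    Function.Injective (X.act' l y)
  act'_range : ∀ l, l + 1 < n → ∀ ⦃V : X.E⦄ (y : X.Fib (l + 2) V),
    (X.act' l y).range =
      ((X.act l ((X.fibMap (l + 1) V).obj y)).range).comap ((X.p (l + 1)).mapAut y.1)
  act'_res : ∀ l, l + 1 < n → ∀ ⦃V W : X.E⦄ (f : V ⟶ W) (y : X.Fib (l + 2) W)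
    (c : (X.L' (l + 2)).obj.obj (op W)) (φ : y ⟶ y), φ.1 = (X.act' l y (.ofAdd c)).hom →
      ((X.res (l + 2) f).map φ).1 =
        (X.act' l ((X.res (l + 2) f).obj y) (.ofAdd ((X.L' (l + 2)).obj.map f.op c))).hom
  act'_ι : ∀ l, l + 1 < n → ∀ ⦃V : X.E⦄ (y : X.Fib (l + 2) V)
    (c : (X.L (l + 2)).obj.obj (op V)),
    X.act' l y (.ofAdd ((X.ι l).hom.app (op V) c)) = X.act (l + 1) y (.ofAdd c)
  act_π : ∀ l, l + 1 < n → ∀ ⦃V : X.E⦄ (y : X.Fib (l + 2) V)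
    (c : (X.L' (l + 2)).obj.obj (op V)),
    X.act l ((X.fibMap (l + 1) V).obj y) (.ofAdd ((X.π l).hom.app (op V) c)) =
      (X.p (l + 1)).mapAut y.1 (X.act' l y (.ofAdd c))

/-- Restricting twice is restricting along the composition. -/
theorem res_obj_obj {X : TowerData.{w, v, u, v', u'}} {l : ℕ} {V W Z : X.E} (f : V ⟶ W) (g : W ⟶ Z) (k : V ⟶ Z) (h : f ≫ g = k)
    (x : X.Fib l Z) : (X.res l f).obj ((X.res l g).obj x) = (X.res l k).obj x := by
  subst h
  exact Functor.congr_obj (X.res_comp l f g) x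

/-! ### Čech cochains and classifying cocycles -/

section Cech

variable [HasFiniteProducts X.E] {I : Type w} (U : I → X.E)

/-- The product `U_{σ 0} × ⋯ × U_{σ (k - 1)}` over the final object. -/
noncomputable abbrev inter {k : ℕ} (σ : Fin k → I) : X.E := ∏ᶜ (U ∘ σ)

/-- The projection onto one factor. -/
noncomputable def proj {k : ℕ} (σ : Fin k → I) (a : Fin k) : X.inter U σ ⟶ U (σ a) :=
  Pi.π (U ∘ σ) a

/-- The projection which forgets the last factor. -/
noncomputable def dropLast {k : ℕ} (σ : Fin (k + 1) → I) :
    X.inter U σ ⟶ X.inter U (σ ∘ Fin.castSucc) :=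
  Pi.lift fun a => X.proj U σ a.castSucc

/-- `U` covers the base, and over the intersections of its members the objects are unique up to
isomorphism: `F 1` has objects over `U i`, which are isomorphic, and so are the objects over
`U i × U j`; for each object `x` of `F (l + 1)` over an intersection of finitely many members, the
fiber of `F (l + 2)` over `x` has objects, which are isomorphic. -/
structure IsAdaptedCover (n : ℕ) : Prop where
  coversTop : X.J.CoversTop U
  nonempty_one : 0 < n → ∀ i, Nonempty (X.Fib 1 (U i))
  connected_one : 0 < n → ∀ i, ∀ x y : X.Fib 1 (U i), Nonempty (x ≅ y)
  connected_two : 0 < n → ∀ i j, ∀ x y : X.Fib 1 (U i ⨯ U j), Nonempty (x ≅ y)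
  nonempty_fiber : ∀ l, l + 1 < n → ∀ (k : ℕ) (σ : Fin (k + 1) → I) (x : X.Fib (l + 1) (X.inter U σ)),
    Nonempty ((X.p (l + 1)).Fiber x.1)
  connected_fiber : ∀ l, l + 1 < n → ∀ (k : ℕ) (σ : Fin (k + 1) → I)
    (x : X.Fib (l + 1) (X.inter U σ)) (y y' : (X.p (l + 1)).Fiber x.1), Nonempty (y ≅ y')

/-- The Čech complex of a sheaf with respect to `U`. -/
noncomputable abbrev cech (P : Sheaf X.J AddCommGrpCat.{w}) : CochainComplex AddCommGrpCat.{w} ℕ :=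
  (cechComplexFunctor U).obj P.obj

/-- The map of Čech complexes induced by a map of sheaves. -/
noncomputable abbrev cechMap {P Q : Sheaf X.J AddCommGrpCat.{w}} (f : P ⟶ Q) :
    X.cech U P ⟶ X.cech U Q :=
  (cechComplexFunctor U).map f.hom

/-- The component at `(σ 0, …, σ k)` of a Čech `k`-cochain. -/
noncomputable def comp (P : Sheaf X.J AddCommGrpCat.{w}) {k : ℕ} (c : (X.cech U P).X k)
    (σ : Fin (k + 1) → I) : P.obj.obj (op (X.inter U σ)) :=
  (Pi.π (fun σ : Fin (k + 1) → I => P.obj.obj (op (X.inter U σ))) σ :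
    (X.cech U P).X k ⟶ P.obj.obj (op (X.inter U σ))) c

section Holonomy

variable {X U} (u : ∀ i, X.Fib 1 (U i))
  (v : ∀ i j, (X.res 1 (prod.snd : U i ⨯ U j ⟶ U j)).obj (u j) ≅
    (X.res 1 (prod.fst : U i ⨯ U j ⟶ U i)).obj (u i))

/-- The restriction of `v i j` along `(a, b) : W ⟶ U i × U j`, as an isomorphism between the
restrictions of `u j` and `u i` to `W`. -/
noncomputable def vres {W : X.E} {i j : I} (a : W ⟶ U i) (b : W ⟶ U j) :
    (X.res 1 b).obj (u j) ≅ (X.res 1 a).obj (u i) :=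
  eqToIso (res_obj_obj (prod.lift a b) prod.snd b (prod.lift_snd a b) (u j)).symm ≪≫
    (X.res 1 (prod.lift a b)).mapIso (v i j) ≪≫
      eqToIso (res_obj_obj (prod.lift a b) prod.fst a (prod.lift_fst a b) (u i))

/-- The automorphism `v_{ki} ∘ v_{ij} ∘ v_{jk}` of the restriction of `u k` to
`U i × U j × U k`, where `v_{ki}` is the inverse of `v_{ik}`. -/
noncomputable def holonomy (σ : Fin 3 → I) :
    (X.res 1 (X.proj U σ 2)).obj (u (σ 2)) ≅ (X.res 1 (X.proj U σ 2)).obj (u (σ 2)) :=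
  vres u v (X.proj U σ 1) (X.proj U σ 2) ≪≫ vres u v (X.proj U σ 0) (X.proj U σ 1) ≪≫
    (vres u v (X.proj U σ 0) (X.proj U σ 2)).symm

end Holonomy

/-- `IsClassifying U l x c` : the family `c` of sections of `L (l + 1)` over the intersections of
`l + 3` members of `U` is a classifying cochain of the tower (the one called `c_{l+2}`), for some
choices made up to level `l + 1`; `x` is the family of objects of `F (l + 1)` on which the
components of `c` act as automorphisms.

* At the first level one chooses objects `u i` of `F 1` over `U i` and isomorphisms `v i j` between
  their restrictions to `U i × U j`.
* At each further level one chooses objects `y τ` of `F (l + 2)` over the objects `x τ`, and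
  automorphisms of the `y τ`, given by sections `b τ` of `L' (l + 2)`, over the automorphisms
  of the `x τ` given by the `c τ`. The next cochain is the Čech boundary of `b`. -/
inductive IsClassifying : ∀ l : ℕ, (∀ σ : Fin (l + 3) → I, X.Fib (l + 1) (X.inter U σ)) →
    (X.cech U (X.L (l + 1))).X (l + 2) → Prop
  | zero (u : ∀ i, X.Fib 1 (U i))
      (v : ∀ i j, (X.res 1 (prod.snd : U i ⨯ U j ⟶ U j)).obj (u j) ≅
        (X.res 1 (prod.fst : U i ⨯ U j ⟶ U i)).obj (u i))
      (c : (X.cech U (X.L 1)).X 2)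
      (hc : ∀ σ : Fin 3 → I,
        (X.act 0 ((X.res 1 (X.proj U σ 2)).obj (u (σ 2))) (.ofAdd (X.comp U (X.L 1) c σ))).hom =
          (holonomy u v σ).hom.1) :
      IsClassifying 0 (fun σ => (X.res 1 (X.proj U σ 2)).obj (u (σ 2))) c
  | succ (l : ℕ) (x : ∀ σ : Fin (l + 3) → I, X.Fib (l + 1) (X.inter U σ))
      (c : (X.cech U (X.L (l + 1))).X (l + 2)) (h : IsClassifying l x c)
      (y : ∀ τ : Fin (l + 3) → I, X.Fib (l + 2) (X.inter U τ))
      (hy : ∀ τ, (X.fibMap (l + 1) (X.inter U τ)).obj (y τ) = x τ)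
      (b : (X.cech U (X.L' (l + 2))).X (l + 2))
      (hb : ∀ τ, (X.p (l + 1)).mapAut (y τ).1 (X.act' l (y τ) (.ofAdd (X.comp U (X.L' (l + 2)) b τ))) =
        X.act l ((X.fibMap (l + 1) (X.inter U τ)).obj (y τ))
          (.ofAdd (X.comp U (X.L (l + 1)) c τ)))
      (c' : (X.cech U (X.L (l + 2))).X (l + 3))
      (hc' : (X.cechMap U (X.ι l)).f (l + 3) c' =
        (X.cech U (X.L' (l + 2))).d (l + 2) (l + 3) b) :
      IsClassifying (l + 1)
        (fun σ => (X.res (l + 2) (X.dropLast U σ)).obj (y (σ ∘ Fin.castSucc))) c'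

end Cech

end TowerData

end GerbedTower

namespace GerbedTower

/-! ### Classes of cocycles and the connecting morphism -/

section Classes

variable {K : CochainComplex AddCommGrpCat.{w} ℕ}

/-! Only the gerbe `F 1` calls for a geometric argument. There `c` measures the failure of `v_{ij} ∘
v_{jk}` to equal `v_{ik}`. The two bracketings of a triple composite give the cocycle identity
(`isHolonomy_cocycle`). Isomorphisms `w i : u i ⟶ u' i` compare two systems of choices and produce a
1-cochain whose coboundary is the difference of the two cochains (`isHolonomy_sub`). Both
computations rest on the fact that the band commutes with every arrow of a fiber (`fibAct_comp`).

All higher levels are homological algebra. Lifting of arrows and connectedness of the fibers make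
`L' ⟶ L` surjective on sections over each intersection (`π_surjective`), so the Čech complexes form
a short exact sequence (`bands_shortExact`). Lifting `c` to `b` and writing the coboundary of `b` as
the image of `c'` is then the snake-lemma recipe for the connecting morphism (`HasClass.δ_eq`).
Since that morphism is a function of classes, independence of the choices passes up by induction,
without comparing the objects chosen at the higher levels. -/

theorem iCycles_injective (k : ℕ) : Function.Injective (K.iCycles k) :=
  (AddCommGrpCat.mono_iff_injective _).1 inferInstance

theorem exists_hasClass {k : ℕ} (c : K.X k) (hc : K.d k (k + 1) c = 0) :
    ∃ ξ : K.homology k, HasClass c ξ := by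
  -- The short complex at `k` ends in degree `next k`, which equals `k + 1` only propositionally;
  -- generalizing the index allows substitution.
  have h : ∀ j, (ComplexShape.up ℕ).next k = j → K.d k j c = 0 → (K.sc k).g c = 0 := by
    rintro _ rfl h
    exact h
  exact ⟨_, (K.sc k).abCyclesIso.inv ⟨c, h _ (CochainComplex.next ℕ k) hc⟩,
    (K.sc k).abCyclesIso_inv_apply_iCycles _, rfl⟩

/-- Cochains which differ by a coboundary have the same class. -/
theorem HasClass.eq_of_eq_add_d {k : ℕ} {c c' : K.X (k + 1)} {ξ ξ' : K.homology (k + 1)}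
    (h : HasClass c ξ) (h' : HasClass c' ξ') (b : K.X k) (hb : c = c' + K.d k (k + 1) b) :
    ξ = ξ' := by
  obtain ⟨z, rfl, rfl⟩ := h
  obtain ⟨z', rfl, rfl⟩ := h'
  have hz : z = z' + K.toCycles k (k + 1) b := by
    apply iCycles_injective
    rw [hb, map_add, ← ConcreteCategory.comp_apply (K.toCycles k (k + 1)), K.toCycles_i]
  rw [hz, map_add, ← ConcreteCategory.comp_apply (K.toCycles k (k + 1)),
    K.toCycles_comp_homologyπ]
  exact add_zero _

/-- The snake defining `δ` runs from opcycles to cycles: the opcycle of `b` lies over the class of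
`c`, and its image among the cycles is the boundary of `b`, which comes from `c'`. -/
theorem HasClass.δ_eq {S : ShortComplex (CochainComplex AddCommGrpCat.{w} ℕ)} (hS : S.ShortExact)
    {i j : ℕ} (hij : (ComplexShape.up ℕ).Rel i j) {c : S.X₃.X i} {c' : S.X₁.X j}
    {ξ : S.X₃.homology i} {ξ' : S.X₁.homology j} (h : HasClass c ξ) (h' : HasClass c' ξ')
    (b : S.X₂.X i) (hb : S.g.f i b = c) (hc' : S.f.f j c' = S.X₂.d i j b) :
    hS.δ i j hij ξ = ξ' := by
  obtain ⟨z, rfl, rfl⟩ := h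
  obtain ⟨z', rfl, rfl⟩ := h'
  -- The elementwise snake lemma is stated relative to a forgetful functor to abelian groups; here
  -- it is the identity.
  let _ : HasForget₂ AddCommGrpCat.{w} AddCommGrpCat.{w} := ⟨𝟭 _, Functor.id_comp _⟩
  have : (forget₂ AddCommGrpCat.{w} AddCommGrpCat.{w}).Additive :=
    inferInstanceAs (𝟭 AddCommGrpCat.{w}).Additive
  have : (forget₂ AddCommGrpCat.{w} AddCommGrpCat.{w}).PreservesHomology :=
    inferInstanceAs (𝟭 AddCommGrpCat.{w}).PreservesHomology
  refine (HomologicalComplex.HomologySequence.snakeInput hS i j hij).δ_apply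
    (S.X₃.homologyπ i z) (S.X₂.pOpcycles i b) z' ?_ ?_
  · change HomologicalComplex.opcyclesMap S.g i (S.X₂.pOpcycles i b) =
      S.X₃.homologyι i (S.X₃.homologyπ i z)
    rw [← ConcreteCategory.comp_apply, ← ConcreteCategory.comp_apply,
      HomologicalComplex.p_opcyclesMap, HomologicalComplex.homology_π_ι,
      ConcreteCategory.comp_apply, ConcreteCategory.comp_apply, hb]
  · change HomologicalComplex.cyclesMap S.f j z' =
      S.X₂.opcyclesToCycles i j (S.X₂.pOpcycles i b)
    apply iCycles_injective
    rw [← ConcreteCategory.comp_apply, ← ConcreteCategory.comp_apply,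
      ← ConcreteCategory.comp_apply, HomologicalComplex.cyclesMap_i,
      HomologicalComplex.pOpcycles_opcyclesToCycles_assoc, HomologicalComplex.toCycles_i,
      ConcreteCategory.comp_apply, hc']

end Classes

namespace TowerData

/-! ### Components of Čech cochains -/

section Cochains

variable {X : TowerData.{w, v, u, v', u'}} [HasFiniteProducts X.E] {I : Type w} (U : I → X.E)

theorem comp_ext {P : Sheaf X.J AddCommGrpCat.{w}} {k : ℕ} {c c' : (X.cech U P).X k}
    (h : ∀ σ, X.comp U P c σ = X.comp U P c' σ) : c = c' :=
  (Concrete.productEquiv (fun σ : Fin (k + 1) → I => P.obj.obj (op (X.inter U σ)))).injective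
    (funext fun σ => ((Concrete.productEquiv_apply_apply _ _ σ).trans (h σ)).trans
      (Concrete.productEquiv_apply_apply _ _ σ).symm)

theorem exists_comp {P : Sheaf X.J AddCommGrpCat.{w}} {k : ℕ}
    (f : ∀ σ : Fin (k + 1) → I, P.obj.obj (op (X.inter U σ))) :
    ∃ c : (X.cech U P).X k, ∀ σ, X.comp U P c σ = f σ :=
  ⟨(Concrete.productEquiv (fun σ : Fin (k + 1) → I => P.obj.obj (op (X.inter U σ)))).symm f,
    fun σ => Concrete.productEquiv_symm_apply_π _ f σ⟩

theorem comp_add {P : Sheaf X.J AddCommGrpCat.{w}} {k : ℕ} (c c' : (X.cech U P).X k)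
    (σ : Fin (k + 1) → I) : X.comp U P (c + c') σ = X.comp U P c σ + X.comp U P c' σ :=
  map_add _ _ _

theorem comp_zero {P : Sheaf X.J AddCommGrpCat.{w}} {k : ℕ} (σ : Fin (k + 1) → I) :
    X.comp U P (0 : (X.cech U P).X k) σ = 0 :=
  map_zero _

theorem comp_cechMap {P Q : Sheaf X.J AddCommGrpCat.{w}} (f : P ⟶ Q) {k : ℕ}
    (c : (X.cech U P).X k) (σ : Fin (k + 1) → I) :
    X.comp U Q ((X.cechMap U f).f k c) σ =
      f.hom.app (op (X.inter U σ)) (X.comp U P c σ) :=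
  ConcreteCategory.congr_hom
    (Limits.Pi.map_π (fun σ : Fin (k + 1) → I => f.hom.app (op (X.inter U σ))) σ) c

/-- The projection which forgets the factor of index `i`. -/
noncomputable def face {k : ℕ} (σ : Fin (k + 2) → I) (i : Fin (k + 2)) :
    X.inter U σ ⟶ X.inter U (σ ∘ i.succAbove) :=
  Pi.lift fun a => X.proj U σ (i.succAbove a)

theorem face_proj {k : ℕ} (σ : Fin (k + 2) → I) (i : Fin (k + 2)) (a : Fin (k + 1)) :
    face U σ i ≫ X.proj U (σ ∘ i.succAbove) a = X.proj U σ (i.succAbove a) :=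
  Limits.Pi.lift_π _ _

/-- The Čech complex is the alternating coface complex of a cosimplicial object, whose coface `i`
is, on the component `σ`, restriction along `face U σ i`. -/
theorem comp_d {P : Sheaf X.J AddCommGrpCat.{w}} {k : ℕ} (c : (X.cech U P).X k)
    (σ : Fin (k + 2) → I) :
    X.comp U P ((X.cech U P).d k (k + 1) c) σ =
      ∑ i : Fin (k + 2), (-1 : ℤ) ^ (i : ℕ) •
        P.obj.map (face U σ i).op (X.comp U P c (σ ∘ i.succAbove)) := by
  let D := (FormalCoproduct.cosimplicialObjectFunctor (FormalCoproduct.mk _ U).cech).obj P.obj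
  have hd : (X.cech U P).d k (k + 1) = ∑ i : Fin (k + 2), (-1 : ℤ) ^ (i : ℕ) • D.δ i :=
    CochainComplex.of_d (fun n => D.obj (SimplexCategory.mk n))
      (AlgebraicTopology.AlternatingCofaceMapComplex.objD D) k
  let q : D.obj (SimplexCategory.mk (k + 1)) ⟶ P.obj.obj (op (X.inter U σ)) :=
    Pi.π (fun σ : Fin (k + 2) → I => P.obj.obj (op (X.inter U σ))) σ
  have hq (i : Fin (k + 2)) : D.δ i ≫ q =
      Pi.π (fun σ : Fin (k + 1) → I => P.obj.obj (op (X.inter U σ))) (σ ∘ i.succAbove) ≫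
        P.obj.map (face U σ i).op :=
    Limits.Pi.lift_π (fun σ : Fin (k + 2) → I =>
      Pi.π (fun σ : Fin (k + 1) → I => P.obj.obj (op (X.inter U σ))) (σ ∘ i.succAbove) ≫
        P.obj.map (face U σ i).op) σ
  have h : (X.cech U P).d k (k + 1) ≫ q = ∑ i : Fin (k + 2), (-1 : ℤ) ^ (i : ℕ) •
      (Pi.π (fun σ : Fin (k + 1) → I => P.obj.obj (op (X.inter U σ))) (σ ∘ i.succAbove) ≫
        P.obj.map (face U σ i).op) := by
    rw [hd]
    refine (Preadditive.sum_comp _ _ _).trans (Finset.sum_congr rfl fun i _ => ?_)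
    rw [← hq]
    exact Preadditive.zsmul_comp _ _ _
  refine (ConcreteCategory.congr_hom h c).trans ?_
  refine (congrFun (congrArg DFunLike.coe (map_sum AddCommGrpCat.homAddEquiv _ _)) _).trans ?_
  rw [AddMonoidHom.finsetSum_apply]
  rfl

end Cochains

/-! ### The short exact sequence of bands -/

section Bands

theorem map_comp_eq_of_isHomLift {C : Type u₁} [Category.{v₁} C] {G : Type u₂} [Category.{v₂} G]
    (p : G ⥤ C) {y y₁ z : G} {x : C} {f : x ⟶ p.obj z} {e : y ⟶ y₁} {f' : y₁ ⟶ z}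
    {hx : p.obj y = x} (he : p.IsHomLift (𝟙 x) e) (hf : p.IsHomLift f f') :
    p.map (e ≫ f') = eqToHom hx ≫ f := by
  have := IsHomLift.fac' p (𝟙 x ≫ f) (e ≫ f')
  simpa using this

variable {X : TowerData.{w, v, u, v', u'}} {n : ℕ} {l : ℕ} {V : X.E}

theorem act_injective_add (hX : X.IsGerbedTower n) (hl : l < n) (x : X.Fib (l + 1) V)
    {c c' : (X.L (l + 1)).obj.obj (op V)}
    (h : X.act l x (.ofAdd c) = X.act l x (.ofAdd c')) : c = c' :=
  Multiplicative.ofAdd.injective (hX.act_injective l hl x h)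

theorem ι_injective (hX : X.IsGerbedTower n) (hX' : X.IsCommutative n) (hl : l + 1 < n)
    (y : X.Fib (l + 2) V) : Function.Injective ((X.ι l).hom.app (op V)) := fun a a' h =>
  act_injective_add hX hl y (by rw [← hX'.act'_ι l hl, ← hX'.act'_ι l hl, h])

/-- Read on the object `y`, a section of `L'` dies in `L` exactly when its automorphism lies over
the identity, and such automorphisms form the band of the upper level. -/
theorem π_eq_zero_iff (hX : X.IsGerbedTower n) (hX' : X.IsCommutative n) (hl : l + 1 < n)
    (y : X.Fib (l + 2) V) (b : (X.L' (l + 2)).obj.obj (op V)) :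
    (X.π l).hom.app (op V) b = 0 ↔ ∃ a, (X.ι l).hom.app (op V) a = b := by
  have hker (g : Aut y.1) : (X.p (l + 1)).mapAut y.1 g = 1 ↔
      ∃ a : (X.L (l + 2)).obj.obj (op V), X.act (l + 1) y (.ofAdd a) = g := by
    rw [← MonoidHom.mem_ker, show ((X.p (l + 1)).mapAut y.1).ker = vertAut (X.p (l + 1)) y.1 from rfl,
      ← hX.act_range (l + 1) hl]
    exact Iff.rfl
  have hπ : (X.π l).hom.app (op V) b = 0 ↔
      (X.p (l + 1)).mapAut y.1 (X.act' l y (.ofAdd b)) = 1 := by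
    rw [← hX'.act_π l hl]
    refine ⟨fun h => ?_, fun h => act_injective_add hX (by omega) _ (h.trans ?_)⟩
    · rw [h]
      exact map_one _
    · exact (map_one _).symm
  rw [hπ, hker]
  refine exists_congr fun a => ?_
  rw [← hX'.act'_ι l hl]
  exact ⟨fun h => Multiplicative.ofAdd.injective (hX'.act'_injective l hl y h),
    fun h => by rw [h]⟩

theorem π_eq_of_mapAut_eq (hX : X.IsGerbedTower n) (hX' : X.IsCommutative n) (hl : l + 1 < n)
    (y : X.Fib (l + 2) V) (b : (X.L' (l + 2)).obj.obj (op V)) (c : (X.L (l + 1)).obj.obj (op V))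
    (h : (X.p (l + 1)).mapAut y.1 (X.act' l y (.ofAdd b)) =
      X.act l ((X.fibMap (l + 1) V).obj y) (.ofAdd c)) :
    (X.π l).hom.app (op V) b = c :=
  act_injective_add hX (by omega) _ ((hX'.act_π l hl y b).trans h)

/-- If the objects over `p y` are isomorphic, the automorphisms of `p y` in the band lift
to automorphisms of `y`. -/
theorem π_surjective (hX : X.IsGerbedTower n) (hX' : X.IsCommutative n) (hl : l + 1 < n)
    (y : X.Fib (l + 2) V)
    (hy : ∀ y₁ y₂ : (X.p (l + 1)).Fiber ((X.p (l + 1)).obj y.1), Nonempty (y₁ ≅ y₂)) :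
    Function.Surjective ((X.π l).hom.app (op V)) := by
  intro c
  let f : (X.p (l + 1)).obj y.1 ≅ (X.p (l + 1)).obj y.1 :=
    X.act l ((X.fibMap (l + 1) V).obj y) (.ofAdd c)
  -- The lift of `f` ends at `y` but starts at an uncontrolled `y₁`; an isomorphism `y ≅ y₁` in the
  -- fiber corrects it to an endomorphism of `y` over `f`.
  obtain ⟨y₁, f', hf'⟩ := hX.lift l hl _ _ f.hom ⟨y.1, rfl⟩
  obtain ⟨e⟩ := hy ⟨y.1, rfl⟩ y₁
  have hg : (X.p (l + 1)).map (e.hom.1 ≫ f') = f.hom :=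
    (map_comp_eq_of_isHomLift (hx := rfl) _ e.hom.2 hf').trans (Category.id_comp _)
  have : IsIso (e.hom.1 ≫ f') := by
    -- Invertibility need only be checked in `E`, where the image is that of the isomorphism `f`.
    apply hX.invertible (l + 1) hl
    change IsIso ((X.q (l + 1)).map ((X.p (l + 1)).map (e.hom.1 ≫ f')))
    rw [hg]
    infer_instance
  let g : Aut y.1 := @asIso _ _ _ _ (e.hom.1 ≫ f') this
  have hmap : (X.p (l + 1)).mapAut y.1 g = f := Iso.ext hg
  obtain ⟨b, hb⟩ : g ∈ (X.act' l y).range := by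
    rw [hX'.act'_range l hl]
    exact ⟨.ofAdd c, hmap.symm⟩
  refine ⟨b.toAdd, π_eq_of_mapAut_eq hX hX' hl y _ _ ?_⟩
  rw [ofAdd_toAdd, hb, hmap]

end Bands

/-! ### Exactness of the Čech complexes over an adapted cover. -/

section Covering

variable {X : TowerData.{w, v, u, v', u'}} [HasFiniteProducts X.E] {I : Type w} {U : I → X.E}
  {n : ℕ}

theorem exists_fib_over (hU : X.IsAdaptedCover U n) {l : ℕ} (hl : l + 1 < n) {k : ℕ}
    (σ : Fin (k + 1) → I) (x : X.Fib (l + 1) (X.inter U σ)) :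
    ∃ y : X.Fib (l + 2) (X.inter U σ), (X.fibMap (l + 1) _).obj y = x := by
  obtain ⟨y⟩ := hU.nonempty_fiber l hl k σ x
  exact ⟨⟨y.1, (congrArg (X.q (l + 1)).obj y.2).trans x.2⟩, Subtype.ext y.2⟩

/-- Supplies the objects on which sections are realized as automorphisms when exactness is checked.
-/
theorem nonempty_fib (hU : X.IsAdaptedCover U n) {k : ℕ} (σ : Fin (k + 1) → I) :
    ∀ l < n, Nonempty (X.Fib (l + 1) (X.inter U σ))
  | 0, hl => (hU.nonempty_one hl (σ 0)).map (X.res 1 (X.proj U σ 0)).obj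
  | l + 1, hl => by
    obtain ⟨x⟩ := nonempty_fib hU σ l (by omega)
    obtain ⟨y, -⟩ := exists_fib_over hU hl σ x
    exact ⟨y⟩

/-- Cochains are products of sections over intersections, so exactness is tested one component at a
time, with lifts chosen independently. -/
theorem cech_shortExact {A B C : Sheaf X.J AddCommGrpCat.{w}} (f : A ⟶ B) (g : B ⟶ C)
    (hf : ∀ (k : ℕ) (σ : Fin (k + 1) → I), Function.Injective (f.hom.app (op (X.inter U σ))))
    (hg : ∀ (k : ℕ) (σ : Fin (k + 1) → I), Function.Surjective (g.hom.app (op (X.inter U σ))))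
    (hfg : ∀ (k : ℕ) (σ : Fin (k + 1) → I) (b : B.obj.obj (op (X.inter U σ))),
      g.hom.app (op (X.inter U σ)) b = 0 ↔ ∃ a, f.hom.app (op (X.inter U σ)) a = b) :
    ∃ hw : X.cechMap U f ≫ X.cechMap U g = 0,
      (ShortComplex.mk (X.cechMap U f) (X.cechMap U g) hw).ShortExact := by
  have hw : X.cechMap U f ≫ X.cechMap U g = 0 := by
    ext k c
    refine comp_ext U fun σ => ?_
    refine (comp_cechMap U g _ σ).trans ?_
    refine Eq.trans ((hfg k σ _).2 ⟨X.comp U A c σ, (comp_cechMap U f c σ).symm⟩) ?_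
    exact (comp_zero U σ).symm
  refine ⟨hw, HomologicalComplex.shortExact_of_degreewise_shortExact _ fun k => ?_⟩
  have : Mono ((X.cechMap U f).f k) := by
    refine (AddCommGrpCat.mono_iff_injective _).2 fun a a' h => comp_ext U fun σ => hf k σ ?_
    rw [← comp_cechMap, ← comp_cechMap, h]
  have : Epi ((X.cechMap U g).f k) := by
    refine (AddCommGrpCat.epi_iff_surjective _).2 fun c => ?_
    choose b hb using fun σ => hg k σ (X.comp U C c σ)
    obtain ⟨b', hb'⟩ := exists_comp U b
    exact ⟨b', comp_ext U fun σ => by rw [comp_cechMap, hb', hb]⟩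
  refine ShortComplex.ShortExact.mk' ((ShortComplex.ab_exact_iff _).2 fun b hb => ?_) ‹_› ‹_›
  have hb' (σ : Fin (k + 1) → I) : g.hom.app (op (X.inter U σ)) (X.comp U B b σ) = 0 := by
    refine (comp_cechMap U g b σ).symm.trans ?_
    refine (congrArg (fun c => X.comp U C c σ) hb).trans (comp_zero U σ)
  choose a ha using fun σ => (hfg k σ _).1 (hb' σ)
  obtain ⟨a', ha'⟩ := exists_comp U a
  exact ⟨a', comp_ext U fun σ => by
    refine (comp_cechMap U f a' σ).trans ?_
    rw [ha', ha]⟩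

/-- The short exact sequence of Čech complexes attached to two consecutive bands. -/
theorem bands_shortExact (hX : X.IsGerbedTower n) (hX' : X.IsCommutative n)
    (hU : X.IsAdaptedCover U n) {l : ℕ} (hl : l + 1 < n) :
    ∃ hw : X.cechMap U (X.ι l) ≫ X.cechMap U (X.π l) = 0,
      (ShortComplex.mk (X.cechMap U (X.ι l)) (X.cechMap U (X.π l)) hw).ShortExact := by
  refine cech_shortExact _ _ (fun k σ => ?_) (fun k σ => ?_) fun k σ b => ?_ <;>
    obtain ⟨y⟩ := nonempty_fib hU σ (l + 1) hl
  · exact ι_injective hX hX' hl y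
  · exact π_surjective hX hX' hl y
      (hU.connected_fiber l hl k σ ((X.fibMap (l + 1) _).obj y))
  · exact π_eq_zero_iff hX hX' hl y b

/-! ### Passing from one classifying cochain to the next -/

theorem cechMap_π_eq (hX : X.IsGerbedTower n) (hX' : X.IsCommutative n) {l : ℕ} (hl : l + 1 < n)
    {c : (X.cech U (X.L (l + 1))).X (l + 2)} {y : ∀ τ : Fin (l + 3) → I, X.Fib (l + 2) (X.inter U τ)}
    {b : (X.cech U (X.L' (l + 2))).X (l + 2)}
    (hb : ∀ τ, (X.p (l + 1)).mapAut (y τ).1 (X.act' l (y τ) (.ofAdd (X.comp U (X.L' (l + 2)) b τ))) =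
      X.act l ((X.fibMap (l + 1) (X.inter U τ)).obj (y τ))
        (.ofAdd (X.comp U (X.L (l + 1)) c τ))) :
    (X.cechMap U (X.π l)).f (l + 2) b = c :=
  comp_ext U fun τ => by
    rw [comp_cechMap]
    exact π_eq_of_mapAut_eq hX hX' hl (y τ) _ _ (hb τ)

/-- A classifying cochain of the level `l + 1` comes from a classifying cochain of the level `l`
in the same way as for the connecting morphism. -/
theorem IsClassifying.exists_lift (hX : X.IsGerbedTower n) (hX' : X.IsCommutative n) {l : ℕ}
    (hl : l + 1 < n) {x' : ∀ σ : Fin (l + 4) → I, X.Fib (l + 2) (X.inter U σ)}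
    {c' : (X.cech U (X.L (l + 2))).X (l + 3)} (h : X.IsClassifying U (l + 1) x' c') :
    ∃ x c, X.IsClassifying U l x c ∧ ∃ b : (X.cech U (X.L' (l + 2))).X (l + 2),
      (X.cechMap U (X.π l)).f (l + 2) b = c ∧
      (X.cechMap U (X.ι l)).f (l + 3) c' = (X.cech U (X.L' (l + 2))).d (l + 2) (l + 3) b := by
  cases h with
  | succ _ x c h y hy b hb _ hc' => exact ⟨x, c, h, b, cechMap_π_eq hX hX' hl hb, hc'⟩

/-- Surjectivity of `π` on cochains provides `b`. The cocycle condition on `c` puts the boundary of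
`b` in the kernel of `π`, hence in the image of `ι`. -/
theorem IsClassifying.exists_succ (hX : X.IsGerbedTower n) (hX' : X.IsCommutative n)
    (hU : X.IsAdaptedCover U n) {l : ℕ} (hl : l + 1 < n)
    {x : ∀ σ : Fin (l + 3) → I, X.Fib (l + 1) (X.inter U σ)}
    {c : (X.cech U (X.L (l + 1))).X (l + 2)} (h : X.IsClassifying U l x c)
    (hc : (X.cech U (X.L (l + 1))).d (l + 2) (l + 3) c = 0) :
    ∃ x' c', X.IsClassifying U (l + 1) x' c' := by
  obtain ⟨hw, hS⟩ := bands_shortExact hX hX' hU hl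
  choose y hy using fun τ => exists_fib_over hU hl τ (x τ)
  have := hS.epi_g
  obtain ⟨b, hb⟩ := (AddCommGrpCat.epi_iff_surjective ((X.cechMap U (X.π l)).f (l + 2))).1
    inferInstance c
  have hdb : (X.cechMap U (X.π l)).f (l + 3) ((X.cech U (X.L' (l + 2))).d (l + 2) (l + 3) b) = 0 := by
    rw [← ConcreteCategory.comp_apply, ← HomologicalComplex.Hom.comm,
      ConcreteCategory.comp_apply, hb, hc]
  obtain ⟨c', hc'⟩ := (ShortComplex.ab_exact_iff _).1
    ((HomologicalComplex.shortExact_iff_degreewise_shortExact _).1 hS (l + 3)).exact _ hdb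
  refine ⟨_, c', .succ l x c h y hy b (fun τ => ?_) c' hc'⟩
  rw [← hX'.act_π l hl, ← comp_cechMap, hb]

/-- The coboundary of a classifying cochain of a positive level vanishes. -/
theorem IsClassifying.d_succ_eq_zero (hX : X.IsGerbedTower n) (hX' : X.IsCommutative n)
    (hU : X.IsAdaptedCover U n) {l : ℕ} (hl : l + 1 < n)
    {x' : ∀ σ : Fin (l + 4) → I, X.Fib (l + 2) (X.inter U σ)}
    {c' : (X.cech U (X.L (l + 2))).X (l + 3)} (h : X.IsClassifying U (l + 1) x' c') :
    (X.cech U (X.L (l + 2))).d (l + 3) (l + 4) c' = 0 := by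
  obtain ⟨hw, hS⟩ := bands_shortExact hX hX' hU hl
  obtain ⟨_, _, _, b, _, hb⟩ := h.exists_lift hX hX' hl
  have := hS.mono_f
  -- After the injective map `ι`, the boundary of `c'` becomes the double boundary of `b`.
  apply (AddCommGrpCat.mono_iff_injective ((X.cechMap U (X.ι l)).f (l + 4))).1 inferInstance
  rw [← ConcreteCategory.comp_apply, ← HomologicalComplex.Hom.comm, ConcreteCategory.comp_apply, hb,
    ← ConcreteCategory.comp_apply, HomologicalComplex.d_comp_d, map_zero]
  rfl

end Covering

/-! ### The band of the gerbe acting in its fibers -/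

section FiberAction

variable {X : TowerData.{w, v, u, v', u'}} {n : ℕ}

theorem isHomLift_act_zero (hX : X.IsGerbedTower n) (hn : 0 < n) {V : X.E} (x : X.Fib 1 V)
    (c : (X.L 1).obj.obj (op V)) :
    (X.q 1).IsHomLift (𝟙 V) (X.act 0 x (.ofAdd c)).hom := by
  have h : X.act 0 x (.ofAdd c) ∈ vertAut (X.p 0) x.1 :=
    (hX.act_range 0 hn x).le ⟨.ofAdd c, rfl⟩
  have h' : (X.q 1).map (X.act 0 x (.ofAdd c)).hom = 𝟙 _ := congrArg Iso.hom h
  refine IsHomLift.of_fac' _ _ _ x.2 x.2 ?_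
  rw [h']
  simp

/-- A section of the band of the gerbe `F 1`, as an automorphism in the fiber. -/
def fibAct (hX : X.IsGerbedTower n) (hn : 0 < n) {V : X.E} (x : X.Fib 1 V)
    (c : (X.L 1).obj.obj (op V)) : x ⟶ x :=
  ⟨(X.act 0 x (.ofAdd c)).hom, isHomLift_act_zero hX hn x c⟩

variable (hX : X.IsGerbedTower n) (hn : 0 < n) {V W : X.E}

/-- The order is reversed because a product `f * g` in `Aut` is `g ≫ f`. -/
theorem fibAct_add (x : X.Fib 1 V) (c c' : (X.L 1).obj.obj (op V)) :
    fibAct hX hn x (c + c') = fibAct hX hn x c' ≫ fibAct hX hn x c := by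
  apply Subtype.ext
  change (X.act 0 x (.ofAdd c * .ofAdd c')).hom = _
  rw [map_mul]
  rfl

theorem fibAct_injective (x : X.Fib 1 V) : Function.Injective (fibAct hX hn x) := fun _ _ h =>
  act_injective_add hX hn x (Iso.ext (congrArg Subtype.val h))

include hX hn in
theorem isIso_fib {x y : X.Fib 1 V} (φ : x ⟶ y) : IsIso φ :=
  (hX.gerbe_one hn).isIso_fiber V x y φ

/-- Arrows in a fiber of the gerbe are invertible, so an endomorphism there is a vertical
automorphism and belongs to the band. -/
theorem exists_fibAct (x : X.Fib 1 V) (φ : x ⟶ x) : ∃ c, fibAct hX hn x c = φ := by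
  have := isIso_fib hX hn φ
  let g : Aut x.1 := (Functor.Fiber.fiberInclusion (p := X.q 1) (S := V)).mapIso (asIso φ)
  have hg : g ∈ vertAut (X.p 0) x.1 := by
    refine Iso.ext ?_
    have : (X.q 1).map φ.1 = _ := @IsHomLift.fac' _ _ _ _ (X.q 1) _ _ _ _ (𝟙 V) φ.1 φ.2
    refine this.trans ?_
    simp only [Category.id_comp, eqToHom_trans]
    rfl
  obtain ⟨c, hc⟩ := (hX.act_range 0 hn x).ge hg
  exact ⟨c.toAdd, Subtype.ext (congrArg Iso.hom hc)⟩

/-- Naturality of the band over an identity: sections can be moved past any arrow of a fiber. -/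
theorem fibAct_comp {x y : X.Fib 1 V} (φ : x ⟶ y) (c : (X.L 1).obj.obj (op V)) :
    fibAct hX hn x c ≫ φ = φ ≫ fibAct hX hn y c := by
  apply Subtype.ext
  have h := (hX.band_one hn).natural (𝟙 V) x y φ.1 φ.2 c
  rw [op_id, (X.L 1).obj.map_id] at h
  exact h

theorem res_map_fibAct (f : V ⟶ W) (x : X.Fib 1 W) (c : (X.L 1).obj.obj (op W)) :
    (X.res 1 f).map (fibAct hX hn x c) =
      fibAct hX hn ((X.res 1 f).obj x) ((X.L 1).obj.map f.op c) :=
  Subtype.ext (hX.act_res 0 hn f x c _ rfl)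

end FiberAction

/-! ### Restrictions of the isomorphisms `v i j` -/

section Restriction

variable {X : TowerData.{w, v, u, v', u'}}

theorem res_map_res_map {l : ℕ} {V W Z : X.E} (f : V ⟶ W) (g : W ⟶ Z) {x y : X.Fib l Z}
    (φ : x ⟶ y) :
    (X.res l f).map ((X.res l g).map φ) =
      eqToHom (res_obj_obj f g _ rfl x) ≫ (X.res l (f ≫ g)).map φ ≫
        eqToHom (res_obj_obj f g _ rfl y).symm :=
  Functor.congr_hom (X.res_comp l f g) φ

variable [HasFiniteProducts X.E] {I : Type w} {U : I → X.E} {u : ∀ i, X.Fib 1 (U i)}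
  {v : ∀ i j, (X.res 1 (prod.snd : U i ⨯ U j ⟶ U j)).obj (u j) ≅
    (X.res 1 (prod.fst : U i ⨯ U j ⟶ U i)).obj (u i)}

/-- Replaces the chosen `prod.lift a b` by any map with the same components, as needed after a
further restriction. -/
theorem vres_hom_eq {W : X.E} {i j : I} {a : W ⟶ U i} {b : W ⟶ U j} (k : W ⟶ U i ⨯ U j)
    (ha : k ≫ prod.fst = a) (hb : k ≫ prod.snd = b) :
    (vres u v a b).hom = eqToHom (res_obj_obj k _ _ hb _).symm ≫ (X.res 1 k).map (v i j).hom ≫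
      eqToHom (res_obj_obj k _ _ ha _) := by
  obtain rfl : k = prod.lift a b := Limits.prod.hom_ext
    (ha.trans (prod.lift_fst a b).symm) (hb.trans (prod.lift_snd a b).symm)
  rfl

theorem res_map_vres {W W' : X.E} {i j : I} (h : W' ⟶ W) (a : W ⟶ U i) (b : W ⟶ U j) :
    (X.res 1 h).map (vres u v a b).hom = eqToHom (res_obj_obj h b _ rfl _) ≫
      (vres u v (h ≫ a) (h ≫ b)).hom ≫ eqToHom (res_obj_obj h a _ rfl _).symm := by
  rw [vres_hom_eq (a := a) (b := b) (prod.lift a b) (prod.lift_fst a b)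
      (prod.lift_snd a b),
    vres_hom_eq (a := h ≫ a) (b := h ≫ b) (h ≫ prod.lift a b)
      ((Category.assoc _ _ _).trans (congrArg (h ≫ ·) (prod.lift_fst a b)))
      ((Category.assoc _ _ _).trans (congrArg (h ≫ ·) (prod.lift_snd a b)))]
  simp [res_map_res_map, eqToHom_map]

end Restriction

/-! ### The holonomy of a family of isomorphisms -/

section Holonomy

variable {X : TowerData.{w, v, u, v', u'}} {n : ℕ} (hX : X.IsGerbedTower n) (hn : 0 < n)
  [HasFiniteProducts X.E] {I : Type w} {U : I → X.E} {u : ∀ i, X.Fib 1 (U i)}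
  {v : ∀ i j, (X.res 1 (prod.snd : U i ⨯ U j ⟶ U j)).obj (u j) ≅
    (X.res 1 (prod.fst : U i ⨯ U j ⟶ U i)).obj (u i)}

variable (u v) in
/-- The section `c` of the band measures the difference between `v_{ik}` and `v_{ij} ∘ v_{jk}`,
restricted along maps to the three members of the covering. -/
def IsHolonomy {W : X.E} {i j k : I} (p : W ⟶ U i) (q : W ⟶ U j) (r : W ⟶ U k)
    (c : (X.L 1).obj.obj (op W)) : Prop :=
  (vres u v q r).hom ≫ (vres u v p q).hom =
    fibAct hX hn ((X.res 1 r).obj (u k)) c ≫ (vres u v p r).hom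

theorem isHolonomy_res {W W' : X.E} {i j k : I} {p : W ⟶ U i} {q : W ⟶ U j} {r : W ⟶ U k}
    {c : (X.L 1).obj.obj (op W)} (h : IsHolonomy hX hn u v p q r c) (f : W' ⟶ W) :
    IsHolonomy hX hn u v (f ≫ p) (f ≫ q) (f ≫ r) ((X.L 1).obj.map f.op c) := by
  have h' := congrArg (X.res 1 f).map h
  simp only [Functor.map_comp, res_map_vres, res_map_fibAct, Category.assoc,
    eqToHom_trans_assoc, eqToHom_refl, Category.id_comp] at h'
  -- The section acts on a twice restricted object; centrality carries it across the `eqToHom` to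
  -- the object restricted once, and the outer `eqToHom`s cancel.
  rw [← Category.assoc (fibAct _ _ _ _), fibAct_comp, Category.assoc] at h'
  simp only [← Category.assoc, cancel_mono] at h'
  simp only [Category.assoc, cancel_epi] at h'
  exact h'

theorem isHolonomy_comp {c : (X.cech U (X.L 1)).X 2} (σ : Fin 3 → I)
    (hc : (X.act 0 ((X.res 1 (X.proj U σ 2)).obj (u (σ 2))) (.ofAdd (X.comp U (X.L 1) c σ))).hom =
      (holonomy u v σ).hom.1) :
    IsHolonomy hX hn u v (X.proj U σ 0) (X.proj U σ 1) (X.proj U σ 2) (X.comp U (X.L 1) c σ) := by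
  have h : fibAct hX hn _ (X.comp U (X.L 1) c σ) = (holonomy u v σ).hom := Subtype.ext hc
  rw [IsHolonomy, h]
  simp [holonomy]

/-- The composite `v_{ij} ∘ v_{jk} ∘ v_{kl}` is reduced to `v_{il}` in two ways. In one of them
`cijk` must be moved past `v_{kl}`. -/
theorem isHolonomy_cocycle {W : X.E} {i j k l : I} {p : W ⟶ U i} {q : W ⟶ U j} {r : W ⟶ U k}
    {s : W ⟶ U l} {cijk cijl cikl cjkl : (X.L 1).obj.obj (op W)}
    (hijk : IsHolonomy hX hn u v p q r cijk) (hijl : IsHolonomy hX hn u v p q s cijl)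
    (hikl : IsHolonomy hX hn u v p r s cikl) (hjkl : IsHolonomy hX hn u v q r s cjkl) :
    cijl + cjkl = cikl + cijk := by
  apply fibAct_injective hX hn ((X.res 1 s).obj (u l))
  have h₁ : ((vres u v r s).hom ≫ (vres u v q r).hom) ≫ (vres u v p q).hom =
      fibAct hX hn _ (cijl + cjkl) ≫ (vres u v p s).hom := by
    rw [hjkl, Category.assoc, hijl, fibAct_add, Category.assoc]
  have h₂ : ((vres u v r s).hom ≫ (vres u v q r).hom) ≫ (vres u v p q).hom =
      fibAct hX hn _ (cikl + cijk) ≫ (vres u v p s).hom := by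
    rw [Category.assoc, hijk, ← Category.assoc, ← fibAct_comp, Category.assoc, hikl, fibAct_add,
      Category.assoc]
  exact (cancel_mono _).1 (h₁.symm.trans h₂)

theorem d_holonomy_eq_zero {c : (X.cech U (X.L 1)).X 2}
    (hc : ∀ σ : Fin 3 → I,
      IsHolonomy hX hn u v (X.proj U σ 0) (X.proj U σ 1) (X.proj U σ 2) (X.comp U (X.L 1) c σ)) :
    (X.cech U (X.L 1)).d 2 3 c = 0 := by
  refine comp_ext U fun σ => ?_
  rw [comp_zero, comp_d]
  have h (i : Fin 4) : IsHolonomy hX hn u v (X.proj U σ (i.succAbove 0))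
      (X.proj U σ (i.succAbove 1)) (X.proj U σ (i.succAbove 2))
      ((X.L 1).obj.map (face U σ i).op (X.comp U (X.L 1) c (σ ∘ i.succAbove))) := by
    have := isHolonomy_res hX hn (hc (σ ∘ i.succAbove)) (face U σ i)
    rwa [face_proj, face_proj, face_proj] at this
  -- Face `m` omits the index of position `m`, so the faces 3, 2, 1, 0 carry `ijk`, `ijl`, `ikl`,
  -- `jkl`.
  have := isHolonomy_cocycle hX hn (h 3) (h 2) (h 1) (h 0)
  rw [Fin.sum_univ_four]
  simp only [Fin.val_zero, Fin.val_one, Fin.val_two, show ((3 : Fin 4) : ℕ) = 3 from rfl, pow_zero,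
    pow_one, one_zsmul, neg_zsmul, show (-1 : ℤ) ^ 2 = 1 from rfl,
    show (-1 : ℤ) ^ 3 = -1 from rfl]
  rw [← sub_eq_zero] at this
  rw [← this]
  abel

variable (u v) in
/-- The section `b` of the band measures the difference between `v_{ij}` and `v'_{ij}`,
with respect to isomorphisms `w i : u i ⟶ u' i`. -/
def IsComparison {u' : ∀ i, X.Fib 1 (U i)}
    (v' : ∀ i j, (X.res 1 (prod.snd : U i ⨯ U j ⟶ U j)).obj (u' j) ≅
      (X.res 1 (prod.fst : U i ⨯ U j ⟶ U i)).obj (u' i)) (w : ∀ i, u i ⟶ u' i)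
    {W : X.E} {i j : I} (p : W ⟶ U i) (q : W ⟶ U j) (b : (X.L 1).obj.obj (op W)) : Prop :=
  (vres u v p q).hom ≫ (X.res 1 p).map (w i) =
    fibAct hX hn ((X.res 1 q).obj (u j)) b ≫ (X.res 1 q).map (w j) ≫ (vres u' v' p q).hom

variable {u' : ∀ i, X.Fib 1 (U i)}
  {v' : ∀ i j, (X.res 1 (prod.snd : U i ⨯ U j ⟶ U j)).obj (u' j) ≅
    (X.res 1 (prod.fst : U i ⨯ U j ⟶ U i)).obj (u' i)} {w : ∀ i, u i ⟶ u' i}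

/-- Going around the square formed by `v`, `v'` and `w` is an endomorphism in a fiber, hence a
section of the band. -/
theorem exists_isComparison {W : X.E} {i j : I} (p : W ⟶ U i) (q : W ⟶ U j) :
    ∃ b, IsComparison hX hn u v v' w p q b := by
  have := isIso_fib hX hn (w j)
  obtain ⟨b, hb⟩ := exists_fibAct hX hn ((X.res 1 q).obj (u j))
    ((vres u v p q).hom ≫ (X.res 1 p).map (w i) ≫ (vres u' v' p q).inv ≫
      inv ((X.res 1 q).map (w j)))
  exact ⟨b, by rw [IsComparison, hb]; simp⟩

theorem isComparison_res {W W' : X.E} {i j : I} {p : W ⟶ U i} {q : W ⟶ U j}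
    {b : (X.L 1).obj.obj (op W)} (h : IsComparison hX hn u v v' w p q b) (f : W' ⟶ W) :
    IsComparison hX hn u v v' w (f ≫ p) (f ≫ q) ((X.L 1).obj.map f.op b) := by
  have h' := congrArg (X.res 1 f).map h
  simp only [Functor.map_comp, res_map_vres, res_map_res_map, res_map_fibAct, Category.assoc,
    eqToHom_trans_assoc, eqToHom_refl, Category.id_comp] at h'
  rw [← Category.assoc (fibAct _ _ _ _), fibAct_comp, Category.assoc] at h'
  simp only [← Category.assoc, cancel_mono] at h'
  simp only [Category.assoc, cancel_epi] at h'
  exact h'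

/-- The composite of `v_{jk}`, `v_{ij}` and `w i` is evaluated in two ways: merging the two `v`'s
first, or carrying `w` past them one at a time. -/
theorem isHolonomy_sub {W : X.E} {i j k : I} {p : W ⟶ U i} {q : W ⟶ U j} {r : W ⟶ U k}
    {c c' bij bik bjk : (X.L 1).obj.obj (op W)}
    (hc : IsHolonomy hX hn u v p q r c) (hc' : IsHolonomy hX hn u' v' p q r c')
    (hij : IsComparison hX hn u v v' w p q bij) (hik : IsComparison hX hn u v v' w p r bik)
    (hjk : IsComparison hX hn u v v' w q r bjk) :
    c + bik = c' + (bij + bjk) := by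
  have := isIso_fib hX hn (w k)
  apply fibAct_injective hX hn ((X.res 1 r).obj (u k))
  have h₁ : ((vres u v q r).hom ≫ (vres u v p q).hom) ≫ (X.res 1 p).map (w i) =
      fibAct hX hn _ (c + bik) ≫ (X.res 1 r).map (w k) ≫ (vres u' v' p r).hom := by
    rw [hc, Category.assoc, hik, add_comm, fibAct_add, Category.assoc]
  have h₂ : ((vres u v q r).hom ≫ (vres u v p q).hom) ≫ (X.res 1 p).map (w i) =
      fibAct hX hn _ (c' + (bij + bjk)) ≫ (X.res 1 r).map (w k) ≫ (vres u' v' p r).hom := by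
    rw [Category.assoc, hij, ← Category.assoc, ← fibAct_comp, Category.assoc,
      ← Category.assoc (vres u v q r).hom, hjk, Category.assoc, Category.assoc, hc']
    simp only [← Category.assoc, ← fibAct_add]
    rw [← fibAct_comp, ← Category.assoc, ← fibAct_add, add_comm c', add_comm bij]
  exact (cancel_mono ((X.res 1 r).map (w k) ≫ (vres u' v' p r).hom)).1 (h₁.symm.trans h₂)

theorem exists_holonomy_eq_add_d (w : ∀ i, u i ⟶ u' i) {c c' : (X.cech U (X.L 1)).X 2}
    (hc : ∀ σ : Fin 3 → I,
      IsHolonomy hX hn u v (X.proj U σ 0) (X.proj U σ 1) (X.proj U σ 2) (X.comp U (X.L 1) c σ))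
    (hc' : ∀ σ : Fin 3 → I,
      IsHolonomy hX hn u' v' (X.proj U σ 0) (X.proj U σ 1) (X.proj U σ 2)
        (X.comp U (X.L 1) c' σ)) :
    ∃ b : (X.cech U (X.L 1)).X 1, c = c' + (X.cech U (X.L 1)).d 1 2 b := by
  choose b₀ hb₀ using fun σ : Fin 2 → I =>
    exists_isComparison hX hn (v := v) (v' := v') (w := w) (X.proj U σ 0) (X.proj U σ 1)
  obtain ⟨b, hb⟩ := exists_comp U b₀
  refine ⟨b, comp_ext U fun σ => ?_⟩
  rw [comp_add, comp_d]
  have h (i : Fin 3) : IsComparison hX hn u v v' w (X.proj U σ (i.succAbove 0))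
      (X.proj U σ (i.succAbove 1))
      ((X.L 1).obj.map (face U σ i).op (X.comp U (X.L 1) b (σ ∘ i.succAbove))) := by
    have := isComparison_res hX hn (hb₀ (σ ∘ i.succAbove)) (face U σ i)
    rwa [face_proj, face_proj, ← hb] at this
  have := isHolonomy_sub hX hn (hc σ) (hc' σ) (h 2) (h 1) (h 0)
  rw [Fin.sum_univ_three]
  simp only [Fin.val_zero, Fin.val_one, Fin.val_two, pow_zero,
    pow_one, one_zsmul, neg_zsmul, show (-1 : ℤ) ^ 2 = 1 from rfl]
  rw [eq_sub_of_add_eq this]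
  abel

theorem IsClassifying.exists_isHolonomy
    {x : ∀ σ : Fin 3 → I, X.Fib 1 (X.inter U σ)} {c : (X.cech U (X.L 1)).X 2}
    (h : X.IsClassifying U 0 x c) :
    ∃ u v, ∀ σ : Fin 3 → I,
      IsHolonomy hX hn u v (X.proj U σ 0) (X.proj U σ 1) (X.proj U σ 2)
        (X.comp U (X.L 1) c σ) := by
  cases h with
  | zero u v c hc => exact ⟨u, v, fun σ => isHolonomy_comp hX hn σ (hc σ)⟩

include hX in
theorem exists_isClassifying_zero (hU : X.IsAdaptedCover U n) (hn : 0 < n) :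
    ∃ x c, X.IsClassifying U 0 x c := by
  let u := fun i => (hU.nonempty_one hn i).some
  let v := fun i j => (hU.connected_two hn i j ((X.res 1 prod.snd).obj (u j))
    ((X.res 1 prod.fst).obj (u i))).some
  choose c₀ hc₀ using fun σ : Fin 3 → I => exists_fibAct hX hn _ (holonomy u v σ).hom
  obtain ⟨c, hc⟩ := exists_comp U c₀
  refine ⟨_, c, .zero u v c fun σ => ?_⟩
  rw [hc, ← hc₀]
  rfl

end Holonomy

/-! ### Classifying classes -/

section Classifying

variable {X : TowerData.{w, v, u, v', u'}} {n : ℕ} [HasFiniteProducts X.E] {I : Type w}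
  {U : I → X.E}

theorem IsClassifying.d_eq_zero (hX : X.IsGerbedTower n) (hX' : X.IsCommutative n)
    (hU : X.IsAdaptedCover U n) {l : ℕ} (hl : l < n)
    {x : ∀ σ : Fin (l + 3) → I, X.Fib (l + 1) (X.inter U σ)}
    {c : (X.cech U (X.L (l + 1))).X (l + 2)} (h : X.IsClassifying U l x c) :
    (X.cech U (X.L (l + 1))).d (l + 2) (l + 3) c = 0 := by
  cases l with
  | zero =>
    obtain ⟨u, v, hc⟩ := h.exists_isHolonomy hX hl
    exact d_holonomy_eq_zero hX hl hc
  | succ l => exact h.d_succ_eq_zero hX hX' hU hl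

theorem exists_isClassifying (hX : X.IsGerbedTower n) (hX' : X.IsCommutative n)
    (hU : X.IsAdaptedCover U n) : ∀ l < n, ∃ x c, X.IsClassifying U l x c
  | 0, hl => exists_isClassifying_zero hX hU hl
  | l + 1, hl => by
    obtain ⟨x, c, h⟩ := exists_isClassifying hX hX' hU l (by omega)
    exact h.exists_succ hX hX' hU hl (h.d_eq_zero hX hX' hU (by omega))

/-- The class of a classifying cochain does not depend on the choices. -/
theorem IsClassifying.class_unique (hX : X.IsGerbedTower n) (hX' : X.IsCommutative n)
    (hU : X.IsAdaptedCover U n) {l : ℕ} (hl : l < n)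
    {x x' : ∀ σ : Fin (l + 3) → I, X.Fib (l + 1) (X.inter U σ)}
    {c c' : (X.cech U (X.L (l + 1))).X (l + 2)} (h : X.IsClassifying U l x c)
    (h' : X.IsClassifying U l x' c') {ξ ξ' : (X.cech U (X.L (l + 1))).homology (l + 2)}
    (hξ : HasClass c ξ) (hξ' : HasClass c' ξ') : ξ = ξ' := by
  induction l with
  | zero =>
    obtain ⟨u, v, hc⟩ := h.exists_isHolonomy hX hl
    obtain ⟨u', v', hc'⟩ := h'.exists_isHolonomy hX hl
    obtain ⟨b, hb⟩ := exists_holonomy_eq_add_d hX hl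
      (fun i => (hU.connected_one hl i (u i) (u' i)).some.hom) hc hc'
    exact hξ.eq_of_eq_add_d hξ' b hb
  | succ l ih =>
    obtain ⟨hw, hS⟩ := bands_shortExact hX hX' hU hl
    obtain ⟨x₀, c₀, h₀, b, hb, hbc⟩ := h.exists_lift hX hX' hl
    obtain ⟨x₁, c₁, h₁, b', hb', hbc'⟩ := h'.exists_lift hX hX' hl
    obtain ⟨ξ₀, hξ₀⟩ := exists_hasClass c₀ (h₀.d_eq_zero hX hX' hU (by omega))
    obtain ⟨ξ₁, hξ₁⟩ := exists_hasClass c₁ (h₁.d_eq_zero hX hX' hU (by omega))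
    -- Both classes are images under `δ` of classes one level below, which agree by induction.
    rw [← hξ₀.δ_eq hS (i := l + 2) (j := l + 3) rfl hξ b hb hbc,
      ← hξ₁.δ_eq hS (i := l + 2) (j := l + 3) rfl hξ' b' hb' hbc',
      ih (by omega) h₀ h₁ hξ₀ hξ₁]

/-- The cochain `c'` need not have been built from `c`: it has its own predecessor `c₀`, whose class
equals that of `c` by `class_unique`. -/
theorem IsClassifying.δ_class_eq (hX : X.IsGerbedTower n) (hX' : X.IsCommutative n)
    (hU : X.IsAdaptedCover U n) {l : ℕ} (hl : l + 1 < n)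
    {hw : X.cechMap U (X.ι l) ≫ X.cechMap U (X.π l) = 0}
    (hS : (ShortComplex.mk (X.cechMap U (X.ι l)) (X.cechMap U (X.π l)) hw).ShortExact)
    {x : ∀ σ : Fin (l + 3) → I, X.Fib (l + 1) (X.inter U σ)}
    {c : (X.cech U (X.L (l + 1))).X (l + 2)} (h : X.IsClassifying U l x c)
    {x' : ∀ σ : Fin (l + 4) → I, X.Fib (l + 2) (X.inter U σ)}
    {c' : (X.cech U (X.L (l + 2))).X (l + 3)} (h' : X.IsClassifying U (l + 1) x' c')
    {ξ : (X.cech U (X.L (l + 1))).homology (l + 2)}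
    {ξ' : (X.cech U (X.L (l + 2))).homology (l + 3)}
    (hξ : HasClass c ξ) (hξ' : HasClass c' ξ') : hS.δ (l + 2) (l + 3) rfl ξ = ξ' := by
  obtain ⟨x₀, c₀, h₀, b, hb, hbc⟩ := h'.exists_lift hX hX' hl
  obtain ⟨ξ₀, hξ₀⟩ := exists_hasClass c₀ (h₀.d_eq_zero hX hX' hU (by omega))
  rw [h.class_unique hX hX' hU (by omega) h₀ hξ hξ₀]
  exact hξ₀.δ_eq hS rfl hξ' b hb hbc

end Classifying

end TowerData

end GerbedTower

theorem proposition4p2p3 (n : ℕ) (X : GerbedTower.TowerData.{w, v, u, v', u'})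
    [HasFiniteLimits X.E] (hX : X.IsGerbedTower n) (hX' : X.IsCommutative n)
    {I : Type w} (U : I → X.E) (hU : X.IsAdaptedCover U n) :
    -- classifying cochains exist at each level, and they are cocycles
    (∀ l < n, (∃ x c, X.IsClassifying U l x c) ∧
      ∀ x c, X.IsClassifying U l x c →
        (X.cech U (X.L (l + 1))).d (l + 2) (l + 3) c = 0) ∧
    -- the connecting morphism sends the class of one to the class of the next
    (∀ l, l + 1 < n →
      ∃ (hw : X.cechMap U (X.ι l) ≫ X.cechMap U (X.π l) = 0)
        (hS : (ShortComplex.mk (X.cechMap U (X.ι l)) (X.cechMap U (X.π l)) hw).ShortExact),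
        ∀ x c x' c', X.IsClassifying U l x c → X.IsClassifying U (l + 1) x' c' →
          ∀ ξ ξ', GerbedTower.HasClass c ξ → GerbedTower.HasClass c' ξ' →
            hS.δ (l + 2) (l + 3) rfl ξ = ξ') ∧
    -- the classes are independent of the choices
    (∀ l < n, ∀ x c x' c', X.IsClassifying U l x c → X.IsClassifying U l x' c' →
      ∀ ξ ξ', GerbedTower.HasClass c ξ → GerbedTower.HasClass c' ξ' →
        ξ = ξ') := by
  refine ⟨fun l hl => ⟨GerbedTower.TowerData.exists_isClassifying hX hX' hU l hl,
    fun x c h => h.d_eq_zero hX hX' hU hl⟩, fun l hl => ?_,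
    fun l hl x c x' c' h h' ξ ξ' hξ hξ' => h.class_unique hX hX' hU hl h' hξ hξ'⟩
  obtain ⟨hw, hS⟩ := GerbedTower.TowerData.bands_shortExact hX hX' hU hl
  exact ⟨hw, hS, fun x c x' c' h h' ξ ξ' hξ hξ' => h.δ_class_eq hX hX' hU hl hS h' hξ hξ'⟩
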